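/- Let $n\ge 2$ and $m\ge 1$, let $g_0$ be the Euclidean metric of $\mathbb{R}^n$, let $(F,g_F)$ be a non-empty smooth $m$-dimensional Riemannian manifold, and let $f,h:\mathbb{R}^n\to\mathbb{R}$ be smooth functions with $f>0$. Consider the warped product $M=\mathbb{R}^n\times_f F$, i.e. the manifold $\mathbb{R}^n\times F$ with the metric $g=\pi^*g_0+(f\circ\pi)^2\,\sigma^*g_F$, where $\pi,\sigma$ are the projections of $\mathbb{R}^n\times F$ onto $\mathbb{R}^n$ and $F$. Suppose that $(M,g)$ is a gradient Ricci soliton with potential function $h$ (lifted to $M$ as $h\circ\pi$), that is, $\mathrm{Ric}_g+\mathrm{Hess}_g(h\circ\pi)=\rho\, g$ on $M$ for some constant $\rho\in\mathbb{R}$. Then $f$ is invariant by translation: there are $a=(a_1,\dots,a_n)\in\mathbb{R}^n$ with $a\neq 0$, $b_1,\dots,b_n\in\mathbb{R}$ and a smooth function $P:\mathbb{R}\to\mathbb{R}$ such that $$f(x_1,\dots,x_n)=P\Big(\sum_{i=1}^n (a_ix_i+b_i)\Big)\qquad\text{for all }x\in\mathbb{R}^n .$$ -/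

import Mathlib

open Set Bundle
open scoped Manifold ContDiff

noncomputable section

namespace RiemannianCoord

/-! Riemannian geometry on a finite-dimensional real vector space `E` (the range of a chart).
A metric is given as `G : E → E → E → ℝ`, where `G y u v` is the inner product at `y` of the
constant coordinate vector fields `u` and `v`. -/

variable {E : Type*} [NormedAddCommGroup E] [NormedSpace ℝ E]

/-- The Christoffel symbol of the first kind (Koszul formula on constant fields):
`⟨∇_u v, w⟩ = (∂_u ⟨v, w⟩ + ∂_v ⟨u, w⟩ - ∂_w ⟨u, v⟩) / 2` at `y`. -/
def christoffelFirst (G : E → E → E → ℝ) (y u v w : E) : ℝ :=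
  (fderiv ℝ (fun z => G z v w) y u + fderiv ℝ (fun z => G z u w) y v
    - fderiv ℝ (fun z => G z u v) y w) / 2

open Classical in
/-- The Christoffel symbol `Γ_y(u, v) = ∇_u v` of the Levi-Civita connection: the vector `c` with
`G y c w = christoffelFirst G y u v w` for all `w`. It exists and is unique when `G y` is an inner
product (`E` being finite-dimensional); the value `0` is used if there is no such vector. -/
def christoffel (G : E → E → E → ℝ) (y u v : E) : E :=
  if hc : ∃ c : E, ∀ w : E, G y c w = christoffelFirst G y u v w then hc.choose else 0

/-- The Riemann curvature `R(w, u)v = ∇_w ∇_u v - ∇_u ∇_w v` of constant fields, at `y`. -/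
def curvature (G : E → E → E → ℝ) (y w u v : E) : E :=
  fderiv ℝ (fun z => christoffel G z u v) y w - fderiv ℝ (fun z => christoffel G z w v) y u
    + christoffel G y w (christoffel G y u v) - christoffel G y u (christoffel G y w v)

/-- The Ricci curvature `Ric(u, v)`: the trace of `w ↦ R(w, u)v`. -/
def ricci [FiniteDimensional ℝ E] (G : E → E → E → ℝ) (y u v : E) : ℝ :=
  ∑ i, (Module.finBasis ℝ E).coord i (curvature G y (Module.finBasis ℝ E i) u v)

/-- The Hessian `(∇dh)(u, v) = ∂_u ∂_v h - dh(∇_u v)`. -/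
def hessian (G : E → E → E → ℝ) (h : E → ℝ) (y u v : E) : ℝ :=
  fderiv ℝ (fun z => fderiv ℝ h z v) y u - fderiv ℝ h y (christoffel G y u v)

end RiemannianCoord

section Manifold

variable {E : Type*} [NormedAddCommGroup E] [NormedSpace ℝ E]
  {H : Type*} [TopologicalSpace H] (I : ModelWithCorners ℝ E H) [I.Boundaryless]
  {M : Type*} [TopologicalSpace M] [ChartedSpace H M]

/-- The expression of a metric tensor `g` in the preferred chart `φ` around `x₀`: the pullback of
`g` under `φ⁻¹`. -/
def chartMetric (g : ∀ x : M, TangentSpace I x → TangentSpace I x → ℝ) (x₀ : M)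
    (y u v : E) : ℝ :=
  g ((extChartAt I x₀).symm y)
    (mfderivWithin 𝓘(ℝ, E) I (extChartAt I x₀).symm (range I) y u)
    (mfderivWithin 𝓘(ℝ, E) I (extChartAt I x₀).symm (range I) y v)

/-- The Ricci tensor of the metric tensor `g` at `x`, computed in the preferred chart at `x`
(the chart through which `TangentSpace I x` is identified with `E`). -/
def ricciTensor [FiniteDimensional ℝ E]
    (g : ∀ x : M, TangentSpace I x → TangentSpace I x → ℝ)
    (x : M) (u v : TangentSpace I x) : ℝ :=
  RiemannianCoord.ricci (chartMetric I g x) (extChartAt I x x) u v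

/-- The Hessian of `h` at `x` with respect to the metric tensor `g`, computed in the preferred
chart at `x`. -/
def hessianTensor (g : ∀ x : M, TangentSpace I x → TangentSpace I x → ℝ)
    (h : M → ℝ) (x : M) (u v : TangentSpace I x) : ℝ :=
  RiemannianCoord.hessian (chartMetric I g x) (fun y => h ((extChartAt I x).symm y))
    (extChartAt I x x) u v

/-- `(M, g)` is a gradient Ricci soliton with potential function `h`:
`Ric_g + Hess_g h = ρ g` for some constant `ρ`. -/
def IsGradientRicciSoliton [FiniteDimensional ℝ E]
    (g : ∀ x : M, TangentSpace I x → TangentSpace I x → ℝ) (h : M → ℝ) : Prop :=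
  ∃ ρ : ℝ, ∀ (x : M) (u v : TangentSpace I x),
    ricciTensor I g x u v + hessianTensor I g h x u v = ρ * g x u v

end Manifold

section WarpedProduct

variable {E : Type*} [NormedAddCommGroup E] [NormedSpace ℝ E]
  {H : Type*} [TopologicalSpace H] {I : ModelWithCorners ℝ E H}
  {B : Type*} [TopologicalSpace B] [ChartedSpace H B] [IsManifold I 1 B]
  {E' : Type*} [NormedAddCommGroup E'] [NormedSpace ℝ E']
  {H' : Type*} [TopologicalSpace H'] {J : ModelWithCorners ℝ E' H'}
  {F : Type*} [TopologicalSpace F] [ChartedSpace H' F] [IsManifold J 1 F]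
  {k l : ℕ∞ω}

/-- The metric tensor `π^* g_B + (f ∘ π)^2 σ^* g_F` of the warped product `B ×_f F`, where `π` and
`σ` are the projections of `B × F` to `B` and `F`. -/
def warpedMetric (gB : ContMDiffRiemannianMetric I k E (fun x : B => TangentSpace I x))
    (f : B → ℝ) (gF : ContMDiffRiemannianMetric J l E' (fun q : F => TangentSpace J q))
    (x : B × F) (u v : TangentSpace (I.prod J) x) : ℝ :=
  gB.inner x.1 (mfderiv (I.prod J) I Prod.fst x u) (mfderiv (I.prod J) I Prod.fst x v)
    + f x.1 ^ 2 *
      gF.inner x.2 (mfderiv (I.prod J) J Prod.snd x u) (mfderiv (I.prod J) J Prod.snd x v)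

end WarpedProduct

end

/-!
Only the horizontal part of the soliton equation is needed. For a warped product over a flat base,
`Ric(u, v) = -(m / f) Hess f (u, v)` on horizontal vectors, and the Hessian of a lifted function `h`
on horizontal vectors is the flat one. Hence, on the whole vector space,
`Hess h - (m / f) Hess f = ρ ⟨·, ·⟩` (`exists_horizontal_soliton_equation`).

Differentiating this once more and using that third derivatives commute, all terms cancel but
`∂_w f · Hess f (u, v) = ∂_u f · Hess f (w, v)` (`fderiv_mul_hessian_comm`): where `df ≠ 0`,
the Hessian of `f` is a multiple of `df ⊗ df`. So if `df_p ≠ 0`, then `df` is constant along the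
affine hyperplane `p + ker df_p` (`fderiv_add_eq_of_apply_eq_zero`). If `df_q` did not vanish on `ker df_p`, the
hyperplanes through `p` and `q` would meet, and at a common point `df` would equal both `df_p` and
`df_q`. Therefore `ker df_p ≤ ker df_q` for all `q` (`ker_fderiv_le_ker_fderiv`), and `f` is a
function of the linear form `df_p`. If `df` vanishes identically, `f` is constant.

The Ricci curvature is computed in a chart. The Christoffel symbols with one horizontal argument do
not involve derivatives of the metric of the fibre, and no others enter `Ric` on horizontal vectors.
-/

/-! ### Functions whose Hessian is a multiple of the square of the differential -/

section RankOneHessian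

variable {V : Type*} [NormedAddCommGroup V] [NormedSpace ℝ V] {f : V → ℝ}

theorem contDiff_fderiv_apply {g : V → ℝ} (hg : ContDiff ℝ ∞ g) (v : V) :
    ContDiff ℝ ∞ (fun z => fderiv ℝ g z v) :=
  (hg.fderiv_right (m := ∞) (by simp)).clm_apply contDiff_const

theorem fderiv_fderiv_apply_comm {g : V → ℝ} (hg : ContDiff ℝ ∞ g) (x u v : V) :
    fderiv ℝ (fun z => fderiv ℝ g z v) x u = fderiv ℝ (fun z => fderiv ℝ g z u) x v := by
  have hd : DifferentiableAt ℝ (fderiv ℝ g) x :=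
    (hg.fderiv_right (m := ∞) (by simp)).differentiable (by simp) x
  have hs : IsSymmSndFDerivAt ℝ g x :=
    hg.contDiffAt.isSymmSndFDerivAt
      (by simpa using WithTop.coe_le_coe.2 (le_top : (2 : ℕ∞) ≤ ⊤))
  have key (w : V) : fderiv ℝ (fun z => fderiv ℝ g z w) x = (fderiv ℝ (fderiv ℝ g) x).flip w := by
    rw [fderiv_clm_apply hd (differentiableAt_const _)]
    simp
  simpa [key] using hs u v

theorem hasDerivAt_fderiv_line (hf : ContDiff ℝ ∞ f) (p v z : V) (t : ℝ) :
    HasDerivAt (fun s : ℝ => fderiv ℝ f (p + s • v) z)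
      (fderiv ℝ (fun y => fderiv ℝ f y z) (p + t • v) v) t := by
  have h1 : HasFDerivAt (fun y => fderiv ℝ f y z)
      (fderiv ℝ (fun y => fderiv ℝ f y z) (p + t • v)) (p + t • v) :=
    ((contDiff_fderiv_apply hf z).differentiable (by simp) _).hasFDerivAt
  have h2 : HasDerivAt (fun s : ℝ => p + s • v) v t := by
    simpa using ((hasDerivAt_id t).smul_const v).const_add p
  exact h1.comp_hasDerivAt t h2

theorem eq_of_hasDerivAt_zero_on_ball {g : ℝ → ℝ} {t₀ ε : ℝ}
    (hg : ∀ t ∈ Metric.ball t₀ ε, HasDerivAt g 0 t) {t : ℝ} (ht : t ∈ Metric.ball t₀ ε) :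
    g t = g t₀ := by
  have h0 : t₀ ∈ Metric.ball t₀ ε := Metric.mem_ball_self (Metric.pos_of_mem_ball ht)
  refine Metric.isOpen_ball.is_const_of_deriv_eq_zero (convex_ball t₀ ε).isPreconnected
    (fun s hs => (hg s hs).differentiableAt.differentiableWithinAt)
    (fun s hs => (hg s hs).deriv) ht h0

/-- If the Hessian of `f` is a multiple of `df ⊗ df` where `df ≠ 0`, which is what `H` says, then
`df` is constant along the kernel hyperplane through any noncritical point `p`: the set of times at
which `df` has its initial value along a line in the hyperplane is open and closed. -/
theorem fderiv_add_eq_of_apply_eq_zero (hf : ContDiff ℝ ∞ f)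
    (H : ∀ x u v w : V, fderiv ℝ f x w * fderiv ℝ (fun z => fderiv ℝ f z v) x u =
      fderiv ℝ f x u * fderiv ℝ (fun z => fderiv ℝ f z v) x w)
    {p v : V} (hp : fderiv ℝ f p ≠ 0) (hv : fderiv ℝ f p v = 0) :
    fderiv ℝ f (p + v) = fderiv ℝ f p := by
  obtain ⟨e, he⟩ : ∃ e, fderiv ℝ f p e ≠ 0 := by
    by_contra! hcon
    exact hp (ContinuousLinearMap.ext hcon)
  have hcont : Continuous (fun t : ℝ => fderiv ℝ f (p + t • v)) :=
    (hf.continuous_fderiv (by simp)).comp (by fun_prop)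
  have hclosed : IsClosed {t : ℝ | fderiv ℝ f (p + t • v) = fderiv ℝ f p} :=
    isClosed_eq hcont continuous_const
  have hopen : IsOpen {t : ℝ | fderiv ℝ f (p + t • v) = fderiv ℝ f p} := by
    rw [Metric.isOpen_iff]
    intro t₀ ht₀
    rw [mem_ofPred_eq] at ht₀
    have hce : Continuous (fun t : ℝ => fderiv ℝ f (p + t • v) e) :=
      hcont.clm_apply continuous_const
    obtain ⟨ε, hε, hball⟩ := Metric.eventually_nhds_iff_ball.1
      (hce.continuousAt.eventually_ne (x := t₀) (by simpa [ht₀] using he))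
    -- Along the line, the quotient of `df v` by `df e` has zero derivative, and it starts at `0`.
    have hzero : ∀ t ∈ Metric.ball t₀ ε, fderiv ℝ f (p + t • v) v = 0 := by
      intro t ht
      have hq : ∀ s ∈ Metric.ball t₀ ε, HasDerivAt
          (fun s : ℝ => fderiv ℝ f (p + s • v) v / fderiv ℝ f (p + s • v) e) 0 s := by
        intro s hs
        convert! (hasDerivAt_fderiv_line hf p v v s).div (hasDerivAt_fderiv_line hf p v e s)
          (hball s hs) using 1
        have h1 := H (p + s • v) v v e
        rw [fderiv_fderiv_apply_comm hf _ e v] at h1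
        rw [eq_comm, div_eq_zero_iff]
        left
        linarith
      have := eq_of_hasDerivAt_zero_on_ball hq ht
      simp only [ht₀, hv, zero_div, div_eq_zero_iff] at this
      exact this.resolve_right (hball t ht)
    refine ⟨ε, hε, fun t ht => ContinuousLinearMap.ext fun z => ?_⟩
    rw [← ht₀]
    refine eq_of_hasDerivAt_zero_on_ball (g := fun s : ℝ => fderiv ℝ f (p + s • v) z)
      (fun s hs => ?_) ht
    convert! hasDerivAt_fderiv_line hf p v z s using 1
    have h1 := H (p + s • v) v z e
    rw [hzero s hs, zero_mul] at h1
    exact ((mul_eq_zero.1 h1).resolve_left (hball s hs)).symm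
  have huniv := IsClopen.eq_univ ⟨hclosed, hopen⟩ ⟨0, by simp⟩
  have h1 : (1 : ℝ) ∈ {t : ℝ | fderiv ℝ f (p + t • v) = fderiv ℝ f p} := huniv ▸ mem_univ _
  simpa using h1

/-- Two kernel hyperplanes of `df` through noncritical points are parallel, since `df` would take
both values at a point of intersection. -/
theorem ker_fderiv_le_ker_fderiv (hf : ContDiff ℝ ∞ f)
    (H : ∀ x u v w : V, fderiv ℝ f x w * fderiv ℝ (fun z => fderiv ℝ f z v) x u =
      fderiv ℝ f x u * fderiv ℝ (fun z => fderiv ℝ f z v) x w)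
    {p v : V} (hp : fderiv ℝ f p ≠ 0) (hv : fderiv ℝ f p v = 0) (q : V) :
    fderiv ℝ f q v = 0 := by
  by_contra hqv
  have hq : fderiv ℝ f q ≠ 0 := fun h0 => hqv (by simp [h0])
  -- `p + t • v` is the intersection of the line `p + ℝ v` with the kernel hyperplane through `q`.
  set t : ℝ := fderiv ℝ f q (q - p) / fderiv ℝ f q v with ht
  have h1 : fderiv ℝ f (p + t • v) = fderiv ℝ f p :=
    fderiv_add_eq_of_apply_eq_zero hf H hp (by simp [hv])
  have h2 : fderiv ℝ f (q + (p + t • v - q)) = fderiv ℝ f q := by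
    refine fderiv_add_eq_of_apply_eq_zero hf H hq ?_
    have h3 : t * fderiv ℝ f q v = fderiv ℝ f q (q - p) := by rw [ht]; field_simp
    have h4 : p + t • v - q = t • v - (q - p) := by abel
    rw [h4, map_sub, map_smul, smul_eq_mul, h3, sub_self]
  rw [add_sub_cancel] at h2
  exact hqv (by rw [← h2, h1, hv])

theorem eq_of_fderiv_apply_sub_eq_zero (hf : Differentiable ℝ f) {x y : V}
    (h : ∀ z, fderiv ℝ f z (x - y) = 0) : f x = f y := by
  have hd : ∀ t : ℝ, HasDerivAt (fun s : ℝ => f (y + s • (x - y))) 0 t := by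
    intro t
    have h2 : HasDerivAt (fun s : ℝ => y + s • (x - y)) (x - y) t := by
      simpa using ((hasDerivAt_id t).smul_const (x - y)).const_add y
    have := (hf (y + t • (x - y))).hasFDerivAt.comp_hasDerivAt t h2
    rwa [h] at this
  have := is_const_of_deriv_eq_zero (fun t => (hd t).differentiableAt) (fun t => (hd t).deriv) 1 0
  simpa using this

theorem exists_eq_comp_continuousLinearMap (hf : ContDiff ℝ ∞ f)
    (H : ∀ x u v w : V, fderiv ℝ f x w * fderiv ℝ (fun z => fderiv ℝ f z v) x u =
      fderiv ℝ f x u * fderiv ℝ (fun z => fderiv ℝ f z v) x w)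
    {p : V} (hp : fderiv ℝ f p ≠ 0) :
    ∃ P : ℝ → ℝ, ContDiff ℝ ∞ P ∧ ∀ x, f x = P (fderiv ℝ f p x) := by
  obtain ⟨e, he⟩ : ∃ e, fderiv ℝ f p e ≠ 0 := by
    by_contra! hcon
    exact hp (ContinuousLinearMap.ext hcon)
  refine ⟨fun t => f ((t / fderiv ℝ f p e) • e), hf.comp (by fun_prop), fun x => ?_⟩
  refine eq_of_fderiv_apply_sub_eq_zero (hf.differentiable (by simp)) fun z => ?_
  refine ker_fderiv_le_ker_fderiv hf H hp ?_ z
  rw [map_sub, map_smul, smul_eq_mul, div_mul_cancel₀ _ he, sub_self]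

end RankOneHessian

/-- The integrability condition of the equation `Hess h - (μ / f) Hess f = ρ ⟨·, ·⟩`, from the
symmetry of the third derivatives of `h` and of `f`. -/
theorem fderiv_mul_hessian_comm {V : Type*} [NormedAddCommGroup V] [InnerProductSpace ℝ V]
    {f h : V → ℝ} (hf : ContDiff ℝ ∞ f) (hh : ContDiff ℝ ∞ h) (hf0 : ∀ x, f x ≠ 0)
    {μ ρ : ℝ} (hμ : μ ≠ 0)
    (hEq : ∀ x u v : V, -(μ / f x * fderiv ℝ (fun z => fderiv ℝ f z v) x u) +
      fderiv ℝ (fun z => fderiv ℝ h z v) x u = ρ * inner ℝ u v) (x u v w : V) :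
    fderiv ℝ f x w * fderiv ℝ (fun z => fderiv ℝ f z v) x u =
      fderiv ℝ f x u * fderiv ℝ (fun z => fderiv ℝ f z v) x w := by
  have hfv := contDiff_fderiv_apply hf v
  have hhv := contDiff_fderiv_apply hh v
  have hder (a b : V) : fderiv ℝ (fun y => fderiv ℝ (fun z => fderiv ℝ h z v) y a) x b =
      μ / f x * fderiv ℝ (fun y => fderiv ℝ (fun z => fderiv ℝ f z v) y a) x b
        - μ / f x ^ 2 * (fderiv ℝ f x b * fderiv ℝ (fun z => fderiv ℝ f z v) x a) := by
    have e1 : (fun y => fderiv ℝ (fun z => fderiv ℝ h z v) y a) =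
        fun y => ρ * inner ℝ a v + μ * (f y)⁻¹ * fderiv ℝ (fun z => fderiv ℝ f z v) y a := by
      funext y
      rw [← hEq y a v]
      ring
    have d1 : HasFDerivAt f (fderiv ℝ f x) x := (hf.differentiable (by simp) x).hasFDerivAt
    have d2 := ((contDiff_fderiv_apply hfv a).differentiable (by simp) x).hasFDerivAt
    have d3 := ((((hasDerivAt_inv (hf0 x)).comp_hasFDerivAt x d1).const_mul μ).mul d2).const_add
      (ρ * inner ℝ a v)
    rw [e1]
    erw [d3.fderiv]
    simp
    field_simp [hf0 x]
    ring
  have hs := fderiv_fderiv_apply_comm hhv x w u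
  rw [hder, hder, fderiv_fderiv_apply_comm hfv x w u] at hs
  have h1 : μ / f x ^ 2 ≠ 0 := div_ne_zero hμ (pow_ne_zero _ (hf0 x))
  exact mul_left_cancel₀ h1 (by linarith)

/-! ### Curvature of warped products over a flat base -/

namespace RiemannianCoord

theorem christoffel_eq_of_forall {E : Type*} [NormedAddCommGroup E] [NormedSpace ℝ E]
    {G : E → E → E → ℝ} {y u v c : E} (hc : ∀ w, G y c w = christoffelFirst G y u v w)
    (huniq : ∀ c', (∀ w, G y c' w = G y c w) → c' = c) : christoffel G y u v = c := by
  have hex : ∃ c : E, ∀ w : E, G y c w = christoffelFirst G y u v w := ⟨c, hc⟩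
  rw [christoffel, dif_pos hex]
  exact huniq _ fun w => by rw [hex.choose_spec w, hc w]

variable {E : Type*} [NormedAddCommGroup E] [InnerProductSpace ℝ E]
  {E' : Type*} [NormedAddCommGroup E'] [NormedSpace ℝ E']

/-- `G` is the warped product of the flat metric of `E` and of the metric `k` with warping
function `f`, over the open set `t` of `E'`. Of `k` only what determines the horizontal Christoffel
symbols is recorded: it is symmetric, homogeneous, nondegenerate and differentiable on `t`. -/
structure IsWarpedOn (f : E → ℝ) (k : E' → E' → E' → ℝ) (t : Set E')
    (G : E × E' → E × E' → E × E' → ℝ) : Prop where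
  isOpen : IsOpen t
  eq : ∀ y, y.2 ∈ t → ∀ u v, G y u v = inner ℝ u.1 v.1 + f y.1 ^ 2 * k y.2 u.2 v.2
  symm : ∀ y ∈ t, ∀ u v, k y u v = k y v u
  smul : ∀ y ∈ t, ∀ (c : ℝ) (u v), k y (c • u) v = c * k y u v
  nondegenerate : ∀ y ∈ t, ∀ u u', (∀ v, k y u v = k y u' v) → u = u'
  differentiableAt : ∀ y ∈ t, ∀ u v, DifferentiableAt ℝ (fun z => k z u v) y

namespace IsWarpedOn

variable {f : E → ℝ} {k : E' → E' → E' → ℝ} {t : Set E'} {G : E × E' → E × E' → E × E' → ℝ}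
  {y : E × E'}

theorem zero_left (hG : IsWarpedOn f k t G) {z : E'} (hz : z ∈ t) (v : E') : k z 0 v = 0 := by
  simpa using hG.smul z hz 0 0 v

theorem symm_apply (hG : IsWarpedOn f k t G) (hy : y.2 ∈ t) (u v : E × E') :
    G y u v = G y v u := by
  rw [hG.eq y hy, hG.eq y hy, hG.symm _ hy, real_inner_comm]

theorem eventually_mem (hG : IsWarpedOn f k t G) (hy : y.2 ∈ t) : ∀ᶠ z in nhds y, z.2 ∈ t :=
  continuous_snd.continuousAt.eventually_mem (hG.isOpen.mem_nhds hy)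

/-- A vector is determined by its inner products in the warped metric. -/
theorem eq_of_forall (hG : IsWarpedOn f k t G) (hf0 : ∀ x, f x ≠ 0) (hy : y.2 ∈ t)
    {c c' : E × E'} (h : ∀ w, G y c' w = G y c w) : c' = c := by
  have h1 : c'.1 = c.1 := by
    refine ext_inner_right ℝ fun w => ?_
    have := h (w, 0)
    rw [hG.eq y hy, hG.eq y hy, hG.symm _ hy, hG.symm _ hy c.2, hG.zero_left hy,
      hG.zero_left hy] at this
    simpa using this
  refine Prod.ext h1 (hG.nondegenerate _ hy _ _ fun w => ?_)
  have := h (0, w)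
  rw [hG.eq y hy, hG.eq y hy, h1] at this
  exact mul_left_cancel₀ (pow_ne_zero 2 (hf0 y.1)) (add_left_cancel this)

theorem fderiv_horizontal_left (hG : IsWarpedOn f k t G) (hy : y.2 ∈ t) (u : E) (v w : E × E') :
    fderiv ℝ (fun z => G z (u, 0) v) y w = 0 := by
  have : (fun z => G z (u, 0) v) =ᶠ[nhds y] fun _ => inner ℝ u v.1 := by
    filter_upwards [hG.eventually_mem hy] with z hz
    rw [hG.eq z hz, hG.zero_left hz, mul_zero, add_zero]
  rw [this.fderiv_eq]
  simp

theorem fderiv_horizontal_right (hG : IsWarpedOn f k t G) (hy : y.2 ∈ t) (u : E) (v w : E × E') :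
    fderiv ℝ (fun z => G z v (u, 0)) y w = 0 := by
  have : (fun z => G z v (u, 0)) =ᶠ[nhds y] fun z => G z (u, 0) v := by
    filter_upwards [hG.eventually_mem hy] with z hz using hG.symm_apply hz _ _
  rw [this.fderiv_eq, hG.fderiv_horizontal_left hy]

theorem fderiv_apply_horizontal (hG : IsWarpedOn f k t G) (hf : Differentiable ℝ f) (hy : y.2 ∈ t)
    (u : E) (v w : E × E') :
    fderiv ℝ (fun z => G z v w) y (u, 0) = 2 * f y.1 * fderiv ℝ f y.1 u * k y.2 v.2 w.2 := by
  have : (fun z => G z v w) =ᶠ[nhds y]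
      fun z => inner ℝ v.1 w.1 + f z.1 ^ 2 * k z.2 v.2 w.2 := by
    filter_upwards [hG.eventually_mem hy] with z hz using hG.eq z hz _ _
  rw [this.fderiv_eq]
  have d1 : HasFDerivAt (fun z : E × E' => f z.1) _ y :=
    (hf y.1).hasFDerivAt.comp y hasFDerivAt_fst
  have d2 : HasFDerivAt (fun z : E × E' => k z.2 v.2 w.2) _ y :=
    (hG.differentiableAt _ hy v.2 w.2).hasFDerivAt.comp y hasFDerivAt_snd
  have d3 := ((d1.pow 2).mul d2).const_add (inner ℝ v.1 w.1)
  erw [d3.fderiv]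
  simp
  ring

theorem christoffel_horizontal_right (hG : IsWarpedOn f k t G) (hf : Differentiable ℝ f)
    (hf0 : ∀ x, f x ≠ 0) (hy : y.2 ∈ t) (w : E × E') (v : E) :
    christoffel G y w (v, 0) = (0, (fderiv ℝ f y.1 v / f y.1) • w.2) := by
  refine christoffel_eq_of_forall (fun z => ?_) fun c' => hG.eq_of_forall hf0 hy
  rw [christoffelFirst, hG.fderiv_horizontal_left hy, hG.fderiv_horizontal_right hy,
    hG.fderiv_apply_horizontal hf hy, hG.eq y hy, hG.smul _ hy]
  have := hf0 y.1
  simp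
  field_simp

theorem christoffel_horizontal_left (hG : IsWarpedOn f k t G) (hf : Differentiable ℝ f)
    (hf0 : ∀ x, f x ≠ 0) (hy : y.2 ∈ t) (w : E × E') (v : E) :
    christoffel G y (v, 0) w = (0, (fderiv ℝ f y.1 v / f y.1) • w.2) := by
  refine christoffel_eq_of_forall (fun z => ?_) fun c' => hG.eq_of_forall hf0 hy
  rw [christoffelFirst, hG.fderiv_horizontal_left hy, hG.fderiv_horizontal_left hy,
    hG.fderiv_apply_horizontal hf hy, hG.eq y hy, hG.smul _ hy]
  have := hf0 y.1
  simp
  field_simp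

/-- `R(w, u)v = -(Hess f (u, v) / f) w^⊥` for horizontal `u` and `v`, where `w^⊥` is the vertical
part of `w`. -/
theorem curvature_horizontal (hG : IsWarpedOn f k t G) (hf : ContDiff ℝ ∞ f)
    (hf0 : ∀ x, f x ≠ 0) (hy : y.2 ∈ t) (w : E × E') (u v : E) :
    curvature G y w (u, 0) (v, 0) =
      (0, (-(fderiv ℝ (fun z => fderiv ℝ f z v) y.1 u / f y.1)) • w.2) := by
  have hd := hf.differentiable (by simp)
  have e1 : (fun z => christoffel G z (u, 0) (v, 0)) =ᶠ[nhds y] fun _ => 0 := by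
    filter_upwards [hG.eventually_mem hy] with z hz
    rw [hG.christoffel_horizontal_right hd hf0 hz]
    simp
  have e2 : (fun z => christoffel G z w (v, 0)) =ᶠ[nhds y]
      fun z => (0, (fderiv ℝ f z.1 v / f z.1) • w.2) := by
    filter_upwards [hG.eventually_mem hy] with z hz
    rw [hG.christoffel_horizontal_right hd hf0 hz]
  have d1 : HasFDerivAt (fun z : E × E' => f z.1) _ y :=
    (hd y.1).hasFDerivAt.comp y hasFDerivAt_fst
  have d2 : HasFDerivAt (fun z : E × E' => fderiv ℝ f z.1 v) _ y :=
    ((contDiff_fderiv_apply hf v).differentiable (by simp) y.1).hasFDerivAt.comp y hasFDerivAt_fst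
  have d3 := (hasFDerivAt_const (0 : E) y).prodMk
    ((d2.mul ((hasDerivAt_inv (hf0 y.1)).comp_hasFDerivAt y d1)).smul_const w.2)
  have e3 : (fun z : E × E' => ((0 : E), (fderiv ℝ f z.1 v / f z.1) • w.2)) =
      fun z => (0, (fderiv ℝ f z.1 v * (f z.1)⁻¹) • w.2) := by
    simp only [div_eq_mul_inv]
  rw [curvature, e1.fderiv_eq, e2.fderiv_eq, hG.christoffel_horizontal_right hd hf0 hy w v,
    hG.christoffel_horizontal_right hd hf0 hy (u, 0) v,
    hG.christoffel_horizontal_left hd hf0 hy _ u, e3]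
  erw [d3.fderiv]
  -- `∇_u v = 0` for constant horizontal fields, so the third term of the curvature vanishes.
  have h00 : christoffel G y w ((0 : E), (0 : E')) = 0 := by
    rw [hG.christoffel_horizontal_right hd hf0 hy]
    simp
  have := hf0 y.1
  simp only [smul_zero, h00]
  ext
  · simp
  · simp [smul_smul]
    match_scalars
    field_simp
    ring

theorem ricci_horizontal [FiniteDimensional ℝ E] [FiniteDimensional ℝ E']
    (hG : IsWarpedOn f k t G) (hf : ContDiff ℝ ∞ f) (hf0 : ∀ x, f x ≠ 0) (hy : y.2 ∈ t) (u v : E) :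
    ricci G y (u, 0) (v, 0) =
      -(Module.finrank ℝ E' / f y.1 * fderiv ℝ (fun z => fderiv ℝ f z v) y.1 u) := by
  set c : ℝ := -(fderiv ℝ (fun z => fderiv ℝ f z v) y.1 u / f y.1) with hc
  -- By `curvature_horizontal`, `w ↦ R(w, u)v` is `0` on `E` and multiplication by `c` on `E'`.
  set T : (E × E') →ₗ[ℝ] E × E' := LinearMap.prodMap 0 (c • LinearMap.id) with hT
  have hsum : ricci G y (u, 0) (v, 0) = LinearMap.trace ℝ _ T := by
    rw [ricci, LinearMap.trace_eq_matrix_trace ℝ (Module.finBasis ℝ (E × E')), Matrix.trace]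
    refine Finset.sum_congr rfl fun i _ => ?_
    rw [hG.curvature_horizontal hf hf0 hy, Matrix.diag_apply, LinearMap.toMatrix_apply]
    simp [hT, hc]
  rw [hsum, hT, LinearMap.trace_prodMap']
  simp [hc]
  ring

theorem hessian_horizontal (hG : IsWarpedOn f k t G) (hf : Differentiable ℝ f)
    (hf0 : ∀ x, f x ≠ 0) (hy : y.2 ∈ t) {h : E → ℝ} (hh : ContDiff ℝ ∞ h) (u v : E) :
    hessian G (fun z => h z.1) y (u, 0) (v, 0) = fderiv ℝ (fun z => fderiv ℝ h z v) y.1 u := by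
  have e1 (z : E × E') : fderiv ℝ (fun z : E × E' => h z.1) z (v, 0) = fderiv ℝ h z.1 v := by
    have d : HasFDerivAt (fun z : E × E' => h z.1) _ z :=
      (hh.differentiable (by simp) z.1).hasFDerivAt.comp z hasFDerivAt_fst
    rw [d.fderiv]
    simp
  have d : HasFDerivAt (fun z : E × E' => fderiv ℝ h z.1 v) _ y :=
    ((contDiff_fderiv_apply hh v).differentiable (by simp) y.1).hasFDerivAt.comp y hasFDerivAt_fst
  rw [hessian, hG.christoffel_horizontal_right hf hf0 hy]
  simp only [e1]
  rw [d.fderiv]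
  simp only [smul_zero]
  rw [show ((0, 0) : E × E') = 0 from rfl, map_zero]
  simp

end IsWarpedOn

end RiemannianCoord

/-! ### The warped product metric in charts -/

section Charts

variable {V : Type*} [NormedAddCommGroup V] [InnerProductSpace ℝ V]
  {E' : Type*} [NormedAddCommGroup E'] [NormedSpace ℝ E']
  {H' : Type*} [TopologicalSpace H'] {J : ModelWithCorners ℝ E' H'}
  {F : Type*} [TopologicalSpace F] [ChartedSpace H' F]

/-- The preferred charts of `V × F` are the identity on `V`, so that base points are not moved. -/
theorem extChartAt_vectorSpace_prod (x : V × F) :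
    extChartAt (𝓘(ℝ, V).prod J) x = (PartialEquiv.refl V).prod (extChartAt J x.2) := by
  rw [extChartAt_prod, extChartAt_model_space_eq_id]

variable [J.Boundaryless] [IsManifold J ∞ F]

theorem mdifferentiableAt_extChartAt_symm_of_mem_target {q : F} {y : E'}
    (hy : y ∈ (extChartAt J q).target) :
    MDifferentiableAt 𝓘(ℝ, E') J (extChartAt J q).symm y :=
  ((contMDiffOn_extChartAt_symm (n := ∞) q).contMDiffAt
    ((isOpen_extChartAt_target q).mem_nhds hy)).mdifferentiableAt (by simp)

theorem differentiableAt_chartMetric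
    (gF : ContMDiffRiemannianMetric J ∞ E' (fun q : F => TangentSpace J q)) {q : F} {y : E'}
    (hy : y ∈ (extChartAt J q).target) (u v : E') :
    DifferentiableAt ℝ
      (fun z => chartMetric J (fun p a b => gF.inner p a b) q z u v) y := by
  have hopen := isOpen_extChartAt_target (I := J) q
  -- The coordinate vector field `u` of the chart is a differentiable section along `φ⁻¹`.
  have hsec (u : E') : MDifferentiableAt 𝓘(ℝ, E') (J.prod 𝓘(ℝ, E'))
      (fun z => TotalSpace.mk' E' (E := fun p : F => TangentSpace J p) ((extChartAt J q).symm z)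
        (mfderivWithin 𝓘(ℝ, E') J (extChartAt J q).symm (range J) z u)) y := by
    have h1 := (contMDiffOn_extChartAt_symm (I := J) (n := ∞) q).contMDiffOn_tangentMapWithin
      (m := 1) (by
        rw [one_add_one_eq_two]
        simpa using WithTop.coe_le_coe.2 (le_top : (2 : ℕ∞) ≤ ⊤)) hopen.uniqueMDiffOn
    have h2 : ContMDiff 𝓘(ℝ, E') 𝓘(ℝ, E').tangent 1
        (fun z : E' => (⟨z, u⟩ : TangentBundle 𝓘(ℝ, E') E')) :=
      contMDiff_vectorSpace_iff_contDiff.2 contDiff_const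
    have h3 := (h1.comp (t := _) h2.contMDiffOn
      (fun z (hz : z ∈ (extChartAt J q).target) => hz)).contMDiffAt (hopen.mem_nhds hy)
    refine (h3.mdifferentiableAt (by simp)).congr_of_eventuallyEq ?_
    filter_upwards [hopen.mem_nhds hy] with z hz
    simp only [Function.comp_apply, tangentMapWithin, mfderivWithin_of_isOpen hopen hz,
      J.range_eq_univ, mfderivWithin_univ]
  have hg : MDifferentiableAt 𝓘(ℝ, E') (J.prod 𝓘(ℝ, E' →L[ℝ] E' →L[ℝ] ℝ))
      (fun z => TotalSpace.mk' (E' →L[ℝ] E' →L[ℝ] ℝ)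
        (E := fun p : F => TangentSpace J p →L[ℝ] TangentSpace J p →L[ℝ] ℝ)
        ((extChartAt J q).symm z) (gF.inner ((extChartAt J q).symm z))) y :=
    (gF.contMDiff.mdifferentiable (by simp) _).comp y
      (mdifferentiableAt_extChartAt_symm_of_mem_target hy)
  have := MDifferentiableAt.clm_bundle_apply₂ (E₃ := Bundle.Trivial F ℝ) hg (hsec u) (hsec v)
  rw [mdifferentiableAt_totalSpace] at this
  exact this.2.differentiableAt

theorem chartMetric_warpedMetric
    (gF : ContMDiffRiemannianMetric J ∞ E' (fun q : F => TangentSpace J q)) (f : V → ℝ)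
    (x : V × F) {y : V × E'} (hy : y.2 ∈ (extChartAt J x.2).target) (u v : V × E') :
    chartMetric (𝓘(ℝ, V).prod J) (warpedMetric (riemannianMetricVectorSpace V) f gF) x y u v =
      inner ℝ u.1 v.1 + f y.1 ^ 2 *
        chartMetric J (fun p a b => gF.inner p a b) x.2 y.2 u.2 v.2 := by
  have hy' : y ∈ (extChartAt (𝓘(ℝ, V).prod J) x).target := by
    rw [extChartAt_vectorSpace_prod]
    exact ⟨mem_univ _, hy⟩
  have hd : MDifferentiableAt 𝓘(ℝ, V × E') (𝓘(ℝ, V).prod J)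
      (extChartAt (𝓘(ℝ, V).prod J) x).symm y :=
    mdifferentiableAt_extChartAt_symm_of_mem_target hy'
  have hr : range (𝓘(ℝ, V).prod J) = univ := ModelWithCorners.range_eq_univ _
  have hfst (w : V × E') : mfderiv (𝓘(ℝ, V).prod J) 𝓘(ℝ, V) Prod.fst
      ((extChartAt (𝓘(ℝ, V).prod J) x).symm y)
      (mfderivWithin 𝓘(ℝ, V × E') (𝓘(ℝ, V).prod J) (extChartAt (𝓘(ℝ, V).prod J) x).symm
        (range (𝓘(ℝ, V).prod J)) y w) = w.1 := by
    rw [hr, mfderivWithin_univ]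
    refine (mfderiv_comp_apply y mdifferentiableAt_fst hd w).symm.trans ?_
    have : Prod.fst ∘ (extChartAt (𝓘(ℝ, V).prod J) x).symm = (Prod.fst : V × E' → V) := by
      rw [extChartAt_vectorSpace_prod]
      rfl
    rw [this, mfderiv_eq_fderiv, fderiv_fst]
    rfl
  have hsnd (w : V × E') : mfderiv (𝓘(ℝ, V).prod J) J Prod.snd
      ((extChartAt (𝓘(ℝ, V).prod J) x).symm y)
      (mfderivWithin 𝓘(ℝ, V × E') (𝓘(ℝ, V).prod J) (extChartAt (𝓘(ℝ, V).prod J) x).symm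
        (range (𝓘(ℝ, V).prod J)) y w) =
      mfderivWithin 𝓘(ℝ, E') J (extChartAt J x.2).symm (range J) y.2 w.2 := by
    rw [hr, J.range_eq_univ, mfderivWithin_univ, mfderivWithin_univ]
    refine (mfderiv_comp_apply y mdifferentiableAt_snd hd w).symm.trans ?_
    have : Prod.snd ∘ (extChartAt (𝓘(ℝ, V).prod J) x).symm =
        (extChartAt J x.2).symm ∘ (Prod.snd : V × E' → E') := by
      rw [extChartAt_vectorSpace_prod]
      rfl
    rw [this]
    refine (mfderiv_comp_apply y (mdifferentiableAt_extChartAt_symm_of_mem_target hy)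
      differentiableAt_snd.mdifferentiableAt w).trans ?_
    rw [mfderiv_eq_fderiv, fderiv_snd]
    rfl
  refine congrArg₂ (· + ·) (congrArg₂ (fun a b : V => inner ℝ a b) (hfst u) (hfst v))
    (congrArg₂ (· * ·) ?_ ?_)
  · rw [extChartAt_vectorSpace_prod]
    rfl
  · exact congrArg₂ (fun a b => gF.inner ((extChartAt J x.2).symm y.2) a b) (hsnd u) (hsnd v)

theorem isWarpedOn_chartMetric
    (gF : ContMDiffRiemannianMetric J ∞ E' (fun q : F => TangentSpace J q)) (f : V → ℝ)
    (x : V × F) :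
    RiemannianCoord.IsWarpedOn f (chartMetric J (fun p a b => gF.inner p a b) x.2)
      (extChartAt J x.2).target
      (chartMetric (𝓘(ℝ, V).prod J) (warpedMetric (riemannianMetricVectorSpace V) f gF) x) where
  isOpen := isOpen_extChartAt_target x.2
  eq y hy u v := chartMetric_warpedMetric gF f x hy u v
  symm y _ u v := gF.symm _ _ _
  smul y _ c u v := (congrArg
    (fun a => gF.inner _ a _) (map_smul _ c u)).trans (ContinuousLinearMap.map_smul₂ _ c _ _)
  nondegenerate y hy u u' h := by
    have hinj := (isInvertible_mfderivWithin_extChartAt_symm (I := J) hy).injective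
    apply hinj
    by_contra hne
    set A := mfderivWithin 𝓘(ℝ, E') J (extChartAt J x.2).symm (range J) y with hA
    have hpos := gF.pos _ (A u - A u') (sub_ne_zero.2 hne)
    have h1 : A (u - u') = A u - A u' := map_sub A u u'
    have h2 : gF.inner _ (A u) (A (u - u')) = gF.inner _ (A u') (A (u - u')) := h (u - u')
    rw [h1] at h2
    rw [ContinuousLinearMap.map_sub₂, h2, sub_self] at hpos
    exact hpos.false
  differentiableAt y hy u v := differentiableAt_chartMetric gF hy u v

/-- The gradient Ricci soliton equation on horizontal vectors, expressed on the base. -/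
theorem exists_horizontal_soliton_equation [FiniteDimensional ℝ V]
    [FiniteDimensional ℝ E'] [Nonempty F]
    (gF : ContMDiffRiemannianMetric J ∞ E' (fun q : F => TangentSpace J q)) {f h : V → ℝ}
    (hf : ContDiff ℝ ∞ f) (hh : ContDiff ℝ ∞ h) (hf0 : ∀ x, f x ≠ 0)
    (hsol : IsGradientRicciSoliton (𝓘(ℝ, V).prod J)
      (warpedMetric (riemannianMetricVectorSpace V) f gF) (fun x : V × F => h x.1)) :
    ∃ ρ : ℝ, ∀ x u v : V,
      -(Module.finrank ℝ E' / f x * fderiv ℝ (fun z => fderiv ℝ f z v) x u) +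
        fderiv ℝ (fun z => fderiv ℝ h z v) x u = ρ * inner ℝ u v := by
  obtain ⟨ρ, hρ⟩ := hsol
  obtain ⟨q⟩ := ‹Nonempty F›
  refine ⟨ρ, fun x u v => ?_⟩
  have hG := isWarpedOn_chartMetric gF f (x, q)
  have hy : (extChartAt (𝓘(ℝ, V).prod J) (x, q) (x, q)).2 ∈ (extChartAt J q).target := by
    rw [extChartAt_vectorSpace_prod]
    exact mem_extChartAt_target q
  have hy1 : (extChartAt (𝓘(ℝ, V).prod J) (x, q) (x, q)).1 = x := by
    rw [extChartAt_vectorSpace_prod]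
    rfl
  have key := hρ (x, q) (u, 0) (v, 0)
  have hw : warpedMetric (riemannianMetricVectorSpace V) f gF (x, q) (u, 0) (v, 0) =
      inner ℝ u v := by
    have hfst (w : V × E') : mfderiv (𝓘(ℝ, V).prod J) 𝓘(ℝ, V) Prod.fst (x, q) w = w.1 :=
      DFunLike.congr_fun mfderiv_fst w
    have hsnd (w : V × E') : mfderiv (𝓘(ℝ, V).prod J) J Prod.snd (x, q) w = w.2 :=
      DFunLike.congr_fun mfderiv_snd w
    have h0 : gF.inner q (0 : TangentSpace J q) (0 : TangentSpace J q) = 0 := by simp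
    refine (congrArg₂ (· + ·)
      (congrArg₂ (fun a b : V => inner ℝ a b) (hfst (u, 0)) (hfst (v, 0)))
      (congrArg (f x ^ 2 * ·) ((congrArg₂ (fun a b => gF.inner q a b) (hsnd (u, 0))
        (hsnd (v, 0))).trans h0))).trans ?_
    rw [mul_zero, add_zero]
  have hpot : (fun y => h ((extChartAt (𝓘(ℝ, V).prod J) (x, q)).symm y).1) =
      fun y : V × E' => h y.1 := by
    rw [extChartAt_vectorSpace_prod]
    rfl
  change RiemannianCoord.ricci _ _ _ _ + RiemannianCoord.hessian _ _ _ _ _ = _ at key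
  rw [hpot, hG.ricci_horizontal hf hf0 hy,
    hG.hessian_horizontal (hf.differentiable (by simp)) hf0 hy hh, hy1, hw] at key
  exact key

end Charts

/-! ### Gradient Ricci solitons that are warped products over Euclidean space -/

theorem theorem1 (n m : ℕ) (hn : 2 ≤ n) (hm : 1 ≤ m)
    (F : Type*) [TopologicalSpace F] [ChartedSpace (EuclideanSpace ℝ (Fin m)) F]
    [IsManifold (𝓡 m) ∞ F] [Nonempty F]
    (gF : Bundle.ContMDiffRiemannianMetric (𝓡 m) ∞ (EuclideanSpace ℝ (Fin m))
      (fun q : F => TangentSpace (𝓡 m) q))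
    (f h : EuclideanSpace ℝ (Fin n) → ℝ)
    (hf : ContDiff ℝ ∞ f) (hh : ContDiff ℝ ∞ h) (hfpos : ∀ x, 0 < f x)
    (hsol : IsGradientRicciSoliton ((𝓡 n).prod (𝓡 m))
      (warpedMetric (riemannianMetricVectorSpace (EuclideanSpace ℝ (Fin n))) f gF)
      (fun x : EuclideanSpace ℝ (Fin n) × F => h x.1)) :
    ∃ (a b : Fin n → ℝ) (P : ℝ → ℝ), a ≠ 0 ∧ ContDiff ℝ ∞ P ∧
      ∀ x : EuclideanSpace ℝ (Fin n), f x = P (∑ i, (a i * x i + b i)) := by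
  have hf0 : ∀ x, f x ≠ 0 := fun x => (hfpos x).ne'
  obtain ⟨ρ, hρ⟩ := exists_horizontal_soliton_equation gF hf hh hf0 hsol
  by_cases hcrit : ∀ p, fderiv ℝ f p = 0
  -- If `f` is constant, any nonzero `a` will do; `n` must be positive for one to exist.
  · refine ⟨fun _ => 1, 0, fun _ => f 0, fun h0 => ?_, contDiff_const, fun x => ?_⟩
    · exact one_ne_zero (congrFun h0 ⟨0, by omega⟩)
    · exact eq_of_fderiv_apply_sub_eq_zero (hf.differentiable (by simp)) fun z => by simp [hcrit]
  · push Not at hcrit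
    obtain ⟨p, hp⟩ := hcrit
    have hm0 : (Module.finrank ℝ (EuclideanSpace ℝ (Fin m)) : ℝ) ≠ 0 := by
      rw [finrank_euclideanSpace_fin]
      exact_mod_cast (by omega : m ≠ 0)
    obtain ⟨P, hP, hfP⟩ :=
      exists_eq_comp_continuousLinearMap hf (fderiv_mul_hessian_comm hf hh hf0 hm0 hρ) hp
    have hsum (x : EuclideanSpace ℝ (Fin n)) :
        fderiv ℝ f p x = ∑ i, fderiv ℝ f p (EuclideanSpace.single i 1) * x i := by
      conv_lhs => rw [← (EuclideanSpace.basisFun (Fin n) ℝ).sum_repr x]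
      simp [mul_comm]
    refine ⟨fun i => fderiv ℝ f p (EuclideanSpace.single i 1), 0, P, fun h0 => hp ?_, hP,
      fun x => ?_⟩
    · refine ContinuousLinearMap.ext fun x => ?_
      rw [hsum]
      exact Finset.sum_eq_zero fun i _ => by rw [congrFun h0 i]; simp
    · simp [hfP x, hsum x]
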